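/- Let $X$ be the set of sequences $a=(a_1,a_2,\dots)$ of bounded (measurable) complex-valued $2\pi$-periodic functions on $\mathbb R$ (elements of $L^\infty(S^1)$) for which there is $l>0$ with $\sup|a_i|\le l^i$ for all $i\ge 1$. For positive integers $i_1,\dots,i_k$ ($k\ge 0$) define the basic iterated integral $$I_{i_1,\dots,i_k}(a)=\int\cdots\int_{0\le s_1\le\cdots\le s_k\le 2\pi}a_{i_k}(s_k)\cdots a_{i_1}(s_1)\,ds_k\cdots ds_1,$$ equal to $1$ for $k=0$; iterated integrals are the finite complex linear combinations of basic ones. Say that $a\in X$ determines a universal center if $I_{i_1,\dots,i_k}(a)=0$ for all $k\ge1$ and all $i_1,\dots,i_k\geq 1$. For $a,b\in X$ let $a*b\in X$ and $a^{-1}\in X$ be the $2\pi$-periodic sequences with $$(a*b)_i(t)=2a_i(2t)\ (0<t\le\pi),\qquad (a*b)_i(t)=2b_i(2t-2\pi)\ (\pi<t\le2\pi),\qquad (a^{-1})_i(t)=-a_i(2\pi-t)\ (0<t\le2\pi),$$ and write $a\sim b$ if $a*b^{-1}$ determines a universal center. Then $\sim$ is an equivalence relation on $X$, and every iterated integral is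 constant on its classes. The set $G(X)$ of equivalence classes $[a]$ is a group under $[a]\cdot[b]=[a*b]$, with unit $[0]$ and inverse $[a]^{-1}=[a^{-1}]$. Equip $G(X)$ with the weakest topology $\tau$ in which all iterated integrals, viewed as functions on $G(X)$, are continuous. Then: 1. The iterated integrals separate the points of $G(X)$. 2. $(G(X),\cdot,\tau)$ is a separable topological group. 3. $G(X)$ is metrizable and is the union of an increasing sequence of compact subsets. 4. $G(X)$ is contractible to a point, arcwise connected, locally arcwise connected and locally simply connected (every neighbourhood of a point contains a simply connected open neighbourhood of that point). 5. $G(X)$ is residually torsion-free nilpotent, in the sense that finite-dimensional complex unipotent representations separate its elements: for $g\ne h$ in $G(X)$ there are $N$ and a homomorphism $\rho:G(X)\to GL_N(\mathbb C)$ with $\rho(x)-1$ nilpotent for every $x\in G(X)$ and $\rho(g)\ne\rho(h)$. -/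

import Mathlib

open MeasureTheory Topology Real

/-- The vector space `X` of coefficient sequences `a = (a₁, a₂, …)`: every `aᵢ` is a (measurable)
bounded `2π`-periodic complex function, that is, a representative of an element of `L^∞(S¹)`,
and there is `l > 0` with `sup |aᵢ| ≤ l ^ i` for all `i ≥ 1`. -/
structure CoeffSeq where
  /-- the coefficient functions -/
  coeff : ℕ+ → ℝ → ℂ
  measurable_coeff : ∀ i, Measurable (coeff i)
  periodic_coeff : ∀ i, Function.Periodic (coeff i) (2 * π)
  bound : ∃ l : ℝ, 0 < l ∧ ∀ (i : ℕ+) (x : ℝ), ‖coeff i x‖ ≤ l ^ (i : ℕ)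

/-- The representative in `(0, 2π]` of a real number modulo `2π`. -/
noncomputable def angleRep (t : ℝ) : ℝ := toIocMod two_pi_pos 0 t

theorem measurable_angleRep : Measurable angleRep := by
  have h : angleRep = fun t : ℝ => t - (⌈t / (2 * π)⌉ - 1 : ℤ) • (2 * π) := by
    funext t
    have hp : (0 : ℝ) < 2 * π := two_pi_pos
    unfold angleRep toIocMod
    congr 2
    apply toIocDiv_eq_of_sub_zsmul_mem_Ioc
    have h1 := Int.ceil_lt_add_one (t / (2 * π))
    have h2 := Int.le_ceil (t / (2 * π))
    have h3 : t / (2 * π) * (2 * π) = t := div_mul_cancel₀ t hp.ne'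
    have h4 := mul_lt_mul_of_pos_right h1 hp
    have h5 := mul_le_mul_of_nonneg_right h2 hp.le
    simp only [zsmul_eq_mul, Set.mem_Ioc, Int.cast_sub, Int.cast_one]
    constructor <;> nlinarith
  rw [h]
  simp only [zsmul_eq_mul]
  have hc : Measurable fun t : ℝ => ((⌈t / (2 * π)⌉ - 1 : ℤ) : ℝ) := by
    have : Measurable fun t : ℝ => ⌈t / (2 * π)⌉ :=
      Int.measurable_ceil.comp (measurable_id.div_const _)
    exact (measurable_from_top (f := fun n : ℤ => ((n - 1 : ℤ) : ℝ))).comp this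
  exact measurable_id.sub (hc.mul_const _)

theorem angleRep_periodic : Function.Periodic angleRep (2 * π) := fun t =>
  toIocMod_add_right two_pi_pos 0 t

namespace CoeffSeq

/-- The concatenation `a * b`: for `t ∈ (0, 2π]`, its `i`-th coefficient is `2 aᵢ(2t)` if `t ≤ π`
and `2 bᵢ(2t - 2π)` if `t > π`, extended by periodicity. -/
noncomputable def concat (a b : CoeffSeq) : CoeffSeq where
  coeff i t :=
    if angleRep t ≤ π then 2 * a.coeff i (2 * angleRep t)
    else 2 * b.coeff i (2 * angleRep t - 2 * π)
  measurable_coeff i := by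
    have h := measurable_angleRep
    refine Measurable.ite (measurableSet_le h measurable_const) ?_ ?_
    · exact ((a.measurable_coeff i).comp (h.const_mul 2)).const_mul 2
    · exact ((b.measurable_coeff i).comp ((h.const_mul 2).sub_const _)).const_mul 2
  periodic_coeff i t := by
    simp only [angleRep_periodic t]
  bound := by
    obtain ⟨l, hl, ha⟩ := a.bound
    obtain ⟨m, hm, hb⟩ := b.bound
    have key : ∀ (i : ℕ+) (k : ℝ) (z : ℂ), 0 < k → k ≤ max l m → ‖z‖ ≤ k ^ (i : ℕ) →
        ‖2 * z‖ ≤ (2 * max l m) ^ (i : ℕ) := by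
      intro i k z hk hkm hz
      have h2 : (2 : ℝ) ≤ 2 ^ (i : ℕ) := le_self_pow₀ (by norm_num) i.ne_zero
      have h3 : ‖z‖ ≤ max l m ^ (i : ℕ) := hz.trans (pow_le_pow_left₀ hk.le hkm _)
      rw [norm_mul, mul_pow, Complex.norm_ofNat]
      exact mul_le_mul h2 h3 (norm_nonneg _) (by positivity)
    refine ⟨2 * max l m, by positivity, fun i t => ?_⟩
    split_ifs
    · exact key i l _ hl (le_max_left _ _) (ha i _)
    · exact key i m _ hm (le_max_right _ _) (hb i _)

/-- The inverse path `a⁻¹`, with `i`-th coefficient `-aᵢ(2π - t)`. -/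
noncomputable def rev (a : CoeffSeq) : CoeffSeq where
  coeff i t := -a.coeff i (2 * π - t)
  measurable_coeff i := ((a.measurable_coeff i).comp (measurable_const.sub measurable_id)).neg
  periodic_coeff i t := by
    have h := a.periodic_coeff i (2 * π - (t + 2 * π))
    rw [sub_add_eq_sub_sub, sub_add_cancel, ← sub_add_eq_sub_sub] at h
    simp only [h]
  bound := by
    obtain ⟨l, hl, ha⟩ := a.bound
    exact ⟨l, hl, fun i t => by simpa using ha i (2 * π - t)⟩

/-- The zero sequence. -/
noncomputable def zero : CoeffSeq where
  coeff _ _ := 0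
  measurable_coeff _ := measurable_const
  periodic_coeff _ _ := rfl
  bound := ⟨1, one_pos, fun _ _ => by simp⟩

/-- `a.iterFrom [i₁, …, iₖ] c` is the iterated integral
`∫_{c ≤ s₁ ≤ ⋯ ≤ sₖ ≤ 2π} a_{iₖ}(sₖ) ⋯ a_{i₁}(s₁) dsₖ ⋯ ds₁` (equal to `1` for `k = 0`). -/
noncomputable def iterFrom (a : CoeffSeq) : List ℕ+ → ℝ → ℂ
  | [], _ => 1
  | i :: w, c => ∫ s in c..(2 * π), a.coeff i s * iterFrom a w s

/-- The basic iterated integral `I_{i₁,…,iₖ}(a)`, the integral of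
`a_{iₖ}(sₖ) ⋯ a_{i₁}(s₁)` over `0 ≤ s₁ ≤ ⋯ ≤ sₖ ≤ 2π`. -/
noncomputable def iter (w : List ℕ+) (a : CoeffSeq) : ℂ := a.iterFrom w 0

/-- `a` determines a universal center: all basic iterated integrals of order `k ≥ 1` vanish. -/
def IsUniversalCenter (a : CoeffSeq) : Prop := ∀ w : List ℕ+, w ≠ [] → iter w a = 0

/-- The relation `a ∼ b`: the sequence `a * b⁻¹` determines a universal center. -/
def Equivalent (a b : CoeffSeq) : Prop := (a.concat b.rev).IsUniversalCenter

end CoeffSeq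

/-- The set `G(X)` of classes of coefficient sequences modulo `∼`. -/
def CenterGroup : Type := Quot CoeffSeq.Equivalent

namespace CenterGroup

/-- The class `[a]` of a coefficient sequence. -/
def mk (a : CoeffSeq) : CenterGroup := Quot.mk _ a

/-- The basic iterated integral `Î_w` on `G(X)`, evaluated on a representative of the class. -/
noncomputable def basicIntegral (w : List ℕ+) (g : CenterGroup) : ℂ :=
  CoeffSeq.iter w (Quot.out g)

/-- The space `𝓘(G(X))` of iterated integrals on `G(X)`: all linear combinations of basic ones. -/
noncomputable def iteratedIntegrals : Submodule ℂ (CenterGroup → ℂ) :=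
  Submodule.span ℂ (Set.range basicIntegral)

/-- The weakest topology in which all (basic) iterated integrals are continuous. -/
noncomputable instance : TopologicalSpace CenterGroup :=
  ⨅ w : List ℕ+, TopologicalSpace.induced (basicIntegral w) inferInstance

end CenterGroup

/-- Every neighbourhood of every point contains a simply connected (in particular arcwise
connected) open neighbourhood of that point. -/
def IsLocallySimplyConnected (Y : Type*) [TopologicalSpace Y] : Prop :=
  ∀ y : Y, ∀ U ∈ 𝓝 y, ∃ V : Set Y, V ⊆ U ∧ IsOpen V ∧ y ∈ V ∧ SimplyConnectedSpace V

/-- A finite-dimensional complex representation is unipotent if every group element acts as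
the identity plus a nilpotent matrix. -/
def IsUnipotentRep {G : Type*} [Group G] {N : ℕ} (ρ : G →* GL (Fin N) ℂ) : Prop :=
  ∀ x : G, IsNilpotent ((ρ x : Matrix (Fin N) (Fin N) ℂ) - 1)

/-- The finite-dimensional unipotent representations of `G` separate the elements of `G`. -/
def IsResiduallyTorsionFreeNilpotent (G : Type*) [Group G] : Prop :=
  ∀ g h : G, g ≠ h → ∃ (N : ℕ) (ρ : G →* GL (Fin N) ℂ), IsUnipotentRep ρ ∧ ρ g ≠ ρ h

/-! The basic integrals of a sequence form one function on words, and concatenation of sequences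
becomes the deconcatenation product of these functions (Chen's identity, `iter_concat`). Following
`a` by its reverse gives the unit, by symmetry about `π` (`isUniversalCenter_concat_rev`), so `a ∼
b` means that all basic integrals agree (`equivalent_iff`). Hence `G(X)` embeds in the space of
functions on the countable set of words, where the group laws, separation of points, metrizability
and second countability can be read off.

The classes bounded by `l` are the image of a space of Lipschitz primitives, compact for pointwise
convergence. Iterated integrals are continuous there as uniform limits of Riemann–Stieltjes sums
(`continuous_iterFrom_ofPrimitives`).

The dilation `aᵢ ↦ sⁱ aᵢ` multiplies each integral by `s` to the weight of its word, so it contracts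
both `G(X)` and the basic neighbourhoods of `1`; translation gives the local statements. Finally,
the integrals of the factors of a word `w` form a unipotent matrix, multiplicative by Chen's
identity, whose corner entry is the integral of `w`. -/

open scoped NNReal

/-! ### Algebra of the deconcatenation product -/

/-- The product on functions on words dual to deconcatenation: the value at `w` is the sum of
`f u * g v` over all factorizations `w = u ++ v`. -/
def deconcatProd {α R : Type*} [Semiring R] (f g : List α → R) : List α → R
  | [] => f [] * g []
  | i :: w => f [] * g (i :: w) + deconcatProd (fun u => f (i :: u)) g w

section deconcatProd

variable {α R : Type*} [Semiring R]

theorem deconcatProd_nil (f g : List α → R) : deconcatProd f g [] = f [] * g [] := rfl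

theorem deconcatProd_cons (f g : List α → R) (i : α) (w : List α) :
    deconcatProd f g (i :: w) = f [] * g (i :: w) + deconcatProd (fun u => f (i :: u)) g w := rfl

theorem deconcatProd_add_left (f f' g : List α → R) (w : List α) :
    deconcatProd (fun u => f u + f' u) g w = deconcatProd f g w + deconcatProd f' g w := by
  induction w generalizing f f' with
  | nil => simp [deconcatProd_nil, add_mul]
  | cons i w ih => simp only [deconcatProd_cons, ih, add_mul]; abel

theorem deconcatProd_mul_left (k : R) (f g : List α → R) (w : List α) :
    deconcatProd (fun u => k * f u) g w = k * deconcatProd f g w := by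
  induction w generalizing f with
  | nil => simp [deconcatProd_nil, mul_assoc]
  | cons i w ih => simp only [deconcatProd_cons, ih, mul_add, mul_assoc]

theorem deconcatProd_zero_left (g : List α → R) (w : List α) :
    deconcatProd (fun _ => 0) g w = 0 := by
  simpa using deconcatProd_mul_left (0 : R) (fun _ => 0) g w

theorem deconcatProd_assoc (f g h : List α → R) (w : List α) :
    deconcatProd (deconcatProd f g) h w = deconcatProd f (deconcatProd g h) w := by
  induction w generalizing f g with
  | nil => simp [deconcatProd_nil, mul_assoc]
  | cons i w ih =>
    have : (fun u => deconcatProd f g (i :: u)) =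
        fun u => f [] * g (i :: u) + deconcatProd (fun u => f (i :: u)) g u := rfl
    rw [deconcatProd_cons, deconcatProd_cons, this, deconcatProd_add_left, deconcatProd_mul_left]
    change _ + (_ + deconcatProd (deconcatProd _ g) h w) = _
    rw [ih, deconcatProd_cons, deconcatProd_nil, mul_add, mul_assoc, add_assoc]

/-- The unit of the deconcatenation product. -/
def emptyWordIndicator : List α → R
  | [] => 1
  | _ :: _ => 0

theorem emptyWordIndicator_deconcatProd (g : List α → R) :
    deconcatProd emptyWordIndicator g = g := by
  funext w
  cases w with
  | nil => simp [deconcatProd_nil, emptyWordIndicator]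
  | cons i w =>
    rw [deconcatProd_cons]
    simp [emptyWordIndicator, deconcatProd_zero_left]

theorem deconcatProd_emptyWordIndicator (f : List α → R) :
    deconcatProd f emptyWordIndicator = f := by
  funext w
  induction w generalizing f with
  | nil => simp [deconcatProd_nil, emptyWordIndicator]
  | cons i w ih => rw [deconcatProd_cons, ih]; simp [emptyWordIndicator]

theorem deconcatProd_eq_sum (f g : List α → R) (w : List α) :
    deconcatProd f g w = ∑ k ∈ Finset.range (w.length + 1), f (w.take k) * g (w.drop k) := by
  induction w generalizing f with
  | nil => simp [deconcatProd_nil]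
  | cons i w ih =>
    rw [deconcatProd_cons, ih, List.length_cons, Finset.sum_range_succ' _ (w.length + 1), add_comm]
    simp

theorem continuous_deconcatProd {Y : Type*} [TopologicalSpace Y] [TopologicalSpace R]
    [IsTopologicalSemiring R] {f g : Y → List α → R} (hf : ∀ u, Continuous fun y => f y u)
    (hg : ∀ u, Continuous fun y => g y u) (w : List α) :
    Continuous fun y => deconcatProd (f y) (g y) w := by
  simp only [deconcatProd_eq_sum]
  fun_prop

theorem intervalIntegrable_deconcatProd {f : ℝ → List α → ℂ} (g : List α → ℂ) {c d : ℝ}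
    (hf : ∀ u, IntervalIntegrable (fun s => f s u) volume c d) (w : List α) :
    IntervalIntegrable (fun s => deconcatProd (f s) g w) volume c d := by
  induction w generalizing f with
  | nil => exact (hf _).mul_const _
  | cons i w ih => exact ((hf _).mul_const _).add (ih fun u => hf _)

theorem deconcatProd_integral {f : ℝ → List α → ℂ} (g : List α → ℂ) {c d : ℝ}
    (hf : ∀ u, IntervalIntegrable (fun s => f s u) volume c d) (w : List α) :
    deconcatProd (fun u => ∫ s in c..d, f s u) g w = ∫ s in c..d, deconcatProd (f s) g w := by
  induction w generalizing f with
  | nil => simp [deconcatProd_nil]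
  | cons i w ih =>
    simp only [deconcatProd_cons]
    rw [ih fun u => hf _, intervalIntegral.integral_add ((hf _).mul_const _)
      (intervalIntegrable_deconcatProd g (fun u => hf _) w), intervalIntegral.integral_mul_const]

end deconcatProd

/-! ### Chen's identity, reversal and the equivalence relation -/

theorem angleRep_eq_self {t : ℝ} (h : t ∈ Set.Ioc 0 (2 * π)) : angleRep t = t :=
  (toIocMod_eq_self two_pi_pos).2 (by simpa using h)

namespace CoeffSeq

variable (a b : CoeffSeq)

theorem iterFrom_nil (c : ℝ) : a.iterFrom [] c = 1 := rfl

theorem iterFrom_cons (i : ℕ+) (w : List ℕ+) (c : ℝ) :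
    a.iterFrom (i :: w) c = ∫ s in c..(2 * π), a.coeff i s * a.iterFrom w s := rfl

theorem intervalIntegrable_coeff_mul (i : ℕ+) {f : ℝ → ℂ} (hf : Continuous f) (c d : ℝ) :
    IntervalIntegrable (fun s => a.coeff i s * f s) volume c d := by
  obtain ⟨l, -, hl⟩ := a.bound
  refine IntervalIntegrable.mul_continuousOn (f := a.coeff i) ?_ hf.continuousOn
  refine (intervalIntegrable_const (c := l ^ (i : ℕ))).mono_fun
    (a.measurable_coeff i).aestronglyMeasurable (.of_forall fun x => ?_)
  exact (hl i x).trans (le_abs_self _)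

theorem intervalIntegrable_coeff (i : ℕ+) (c d : ℝ) :
    IntervalIntegrable (a.coeff i) volume c d := by
  simpa using a.intervalIntegrable_coeff_mul i continuous_one c d

theorem continuous_iterFrom (w : List ℕ+) : Continuous (a.iterFrom w) := by
  induction w with
  | nil => exact continuous_const
  | cons i w ih =>
    have h := intervalIntegral.continuous_primitive
      (fun c d => a.intervalIntegrable_coeff_mul i ih c d) (2 * π)
    refine h.neg.congr fun c => ?_
    rw [iterFrom_cons, intervalIntegral.integral_symm]
    rfl

theorem iterFrom_two_pi {w : List ℕ+} (hw : w ≠ []) : a.iterFrom w (2 * π) = 0 := by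
  cases w with
  | nil => exact absurd rfl hw
  | cons i w => simp [iterFrom_cons]

/-- Past time `π` only `b` is seen, and the substitution `t = 2s - 2π` absorbs the factor `2`. -/
theorem iterFrom_concat_right (w : List ℕ+) {c : ℝ} (hc : c ∈ Set.Icc 0 (2 * π)) :
    (a.concat b).iterFrom w (π + c / 2) = b.iterFrom w c := by
  induction w generalizing c with
  | nil => rfl
  | cons i w ih =>
    have h2 : π + c / 2 ≤ 2 * π := by linarith [hc.2]
    have key : ∫ s in (π + c / 2)..(2 * π), (a.concat b).coeff i s * (a.concat b).iterFrom w s =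
        ∫ s in (π + c / 2)..(2 * π), (2 : ℝ) •
          (fun t => b.coeff i t * b.iterFrom w t) (2 * s - 2 * π) := by
      apply intervalIntegral.integral_congr_uIoo
      rw [Set.uIoo_of_le h2]
      intro s hs
      have hs0 : π < s := by linarith [hs.1, hc.1]
      have hr : angleRep s = s := angleRep_eq_self ⟨pi_pos.trans hs0, hs.2.le⟩
      have h3 := ih (c := 2 * s - 2 * π) ⟨by linarith, by linarith [hs.2]⟩
      rw [show π + (2 * s - 2 * π) / 2 = s by ring] at h3
      simp only [concat, hr, not_le.2 hs0, if_false] at h3 ⊢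
      rw [h3, Complex.real_smul]
      push_cast
      ring
    rw [iterFrom_cons, key, intervalIntegral.integral_smul]
    refine (intervalIntegral.smul_integral_comp_mul_sub
      (fun t => b.coeff i t * b.iterFrom w t) 2 (2 * π)).trans ?_
    rw [iterFrom_cons]
    congr 1 <;> ring

/-- Chen's identity, with a variable starting point so that induction on the first letter works. The
earliest variable is split at `π`: beyond `π` the whole word is integrated against `b`, the term
with empty prefix; before `π` the first letter goes to `a` and the induction hypothesis treats the
rest. -/
theorem iterFrom_concat_left (w : List ℕ+) {c : ℝ} (hc : c ∈ Set.Icc 0 (2 * π)) :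
    (a.concat b).iterFrom w (c / 2) =
      deconcatProd (fun u => a.iterFrom u c) (fun u => iter u b) w := by
  induction w generalizing c with
  | nil => simp [iterFrom_nil, deconcatProd_nil, iter]
  | cons i w ih =>
    have h2 : c / 2 ≤ π := by linarith [hc.2]
    have key : ∫ s in (c / 2)..π, (a.concat b).coeff i s * (a.concat b).iterFrom w s =
        ∫ s in (c / 2)..π, (2 : ℝ) • (fun t => a.coeff i t *
          deconcatProd (fun u => a.iterFrom u t) (fun u => iter u b) w) (2 * s) := by
      apply intervalIntegral.integral_congr_uIoo
      rw [Set.uIoo_of_le h2]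
      intro s hs
      have hs0 : 0 < s := by linarith [hs.1, hc.1]
      have hr : angleRep s = s := angleRep_eq_self ⟨hs0, by linarith [hs.2]⟩
      have h3 := ih (c := 2 * s) ⟨by linarith, by linarith [hs.2]⟩
      rw [show (2 * s) / 2 = s by ring] at h3
      simp only [concat, hr, hs.2.le, if_true] at h3 ⊢
      rw [h3, Complex.real_smul]
      push_cast
      ring
    have hint := fun c d => (a.concat b).intervalIntegrable_coeff_mul i
      ((a.concat b).continuous_iterFrom w) c d
    have hr := iterFrom_concat_right a b (i :: w) (c := 0) ⟨le_rfl, two_pi_pos.le⟩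
    rw [zero_div, add_zero, iterFrom_cons] at hr
    rw [iterFrom_cons, ← intervalIntegral.integral_add_adjacent_intervals (hint _ π) (hint π _),
      hr, key, intervalIntegral.integral_smul, deconcatProd_cons, iterFrom_nil, one_mul, add_comm]
    congr 1
    refine (intervalIntegral.smul_integral_comp_mul_left (fun t => a.coeff i t *
      deconcatProd (fun u => a.iterFrom u t) (fun u => iter u b) w) 2).trans ?_
    simp only [← deconcatProd_mul_left, mul_div_cancel₀ c (two_ne_zero' ℝ)]
    rw [← deconcatProd_integral]
    · rfl
    · exact fun u => a.intervalIntegrable_coeff_mul i (a.continuous_iterFrom u) _ _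

theorem iter_concat (w : List ℕ+) :
    iter w (a.concat b) = deconcatProd (fun u => iter u a) (fun u => iter u b) w := by
  have h := iterFrom_concat_left a b w (c := 0) ⟨le_rfl, two_pi_pos.le⟩
  rwa [zero_div] at h

/-- If the coefficients are odd about `π`, the iterated integrals are even about `π`. -/
theorem iterFrom_two_pi_sub
    (h : ∀ i, ∀ s ∈ Set.Ioo 0 (2 * π), s ≠ π → a.coeff i (2 * π - s) = -a.coeff i s)
    (w : List ℕ+) {c : ℝ} (hc : c ∈ Set.Icc 0 (2 * π)) :
    a.iterFrom w (2 * π - c) = a.iterFrom w c := by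
  induction w generalizing c with
  | nil => rfl
  | cons i w ih =>
    have hint := fun c d => a.intervalIntegrable_coeff_mul i (a.continuous_iterFrom w) c d
    -- The inner integral is even about `π` by induction, so the integrand is odd and its integral
    -- over `[c, 2π - c]` cancels. The point `π`, where a concatenation need not be odd, is only an
    -- endpoint.
    have hhalf : ∀ c ∈ Set.Icc 0 (2 * π), ∫ s in c..π, a.coeff i s * a.iterFrom w s =
        - ∫ s in π..(2 * π - c), a.coeff i s * a.iterFrom w s := by
      intro c hc
      have h1 := intervalIntegral.integral_comp_sub_left (a := c) (b := π)
        (fun s => a.coeff i s * a.iterFrom w s) (2 * π)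
      rw [show 2 * π - π = π by ring] at h1
      rw [← h1, ← intervalIntegral.integral_neg]
      apply intervalIntegral.integral_congr_uIoo
      intro s hs
      have hs1 : s ∈ Set.Ioo 0 (2 * π) := by
        have := pi_pos
        rcases le_total c π with hcp | hcp
        · rw [Set.uIoo_of_le hcp] at hs; exact ⟨by linarith [hs.1, hc.1], by linarith [hs.2]⟩
        · rw [Set.uIoo_of_ge hcp] at hs; exact ⟨by linarith [hs.1], by linarith [hs.2, hc.2]⟩
      have hs2 : s ≠ π := by
        rintro rfl
        exact Set.right_notMem_uIoo hs
      simp only [h i s hs1 hs2, ih ⟨hs1.1.le, hs1.2.le⟩]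
      ring
    rw [iterFrom_cons, iterFrom_cons, ← intervalIntegral.integral_add_adjacent_intervals
      (hint c π) (hint π (2 * π)), hhalf c hc,
      ← intervalIntegral.integral_add_adjacent_intervals (hint π (2 * π - c)) (hint _ (2 * π))]
    ring

/-- Evenness about `π` equates the integral started at `0` with the one started at `2π`, which is
over a null range. -/
theorem isUniversalCenter_concat_rev : (a.concat a.rev).IsUniversalCenter := by
  intro w hw
  have h := iterFrom_two_pi_sub (a.concat a.rev) ?_ w (c := 0) ⟨le_rfl, two_pi_pos.le⟩
  · rw [sub_zero, iterFrom_two_pi _ hw] at h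
    exact h.symm
  · intro i s hs hsπ
    have h1 : angleRep s = s := angleRep_eq_self ⟨hs.1, hs.2.le⟩
    have h2 : angleRep (2 * π - s) = 2 * π - s :=
      angleRep_eq_self ⟨by linarith [hs.2], by linarith [hs.1]⟩
    simp only [concat, rev, h1, h2]
    rcases lt_or_gt_of_ne hsπ with hlt | hgt
    · rw [if_neg (by linarith), if_pos hlt.le]
      ring_nf
    · rw [if_pos (by linarith), if_neg (by linarith)]
      ring_nf

theorem isUniversalCenter_iff :
    a.IsUniversalCenter ↔ (fun w => iter w a) = emptyWordIndicator := by
  constructor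
  · intro h
    funext w
    cases w with
    | nil => rfl
    | cons i w => exact h _ (by simp)
  · intro h w hw
    rw [show iter w a = emptyWordIndicator w from congrFun h w]
    cases w with
    | nil => exact absurd rfl hw
    | cons i w => rfl

theorem rev_rev : a.rev.rev = a := by
  cases a
  simp [rev]

theorem deconcatProd_rev :
    deconcatProd (fun w => iter w a) (fun w => iter w a.rev) = emptyWordIndicator := by
  rw [← (isUniversalCenter_iff _).1 a.isUniversalCenter_concat_rev]
  funext w
  exact (iter_concat a a.rev w).symm

theorem deconcatProd_rev_left :
    deconcatProd (fun w => iter w a.rev) (fun w => iter w a) = emptyWordIndicator := by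
  simpa only [rev_rev] using a.rev.deconcatProd_rev

/-- The integrals of `b` and of `b.rev` are mutually inverse for the deconcatenation product, so the
factor `b.rev` can be cancelled. -/
theorem equivalent_iff : Equivalent a b ↔ ∀ w, iter w a = iter w b := by
  rw [Equivalent, isUniversalCenter_iff, ← funext_iff]
  have h : (fun w => iter w (a.concat b.rev)) =
      deconcatProd (fun w => iter w a) (fun w => iter w b.rev) := funext fun w => iter_concat ..
  rw [h]
  constructor
  · intro h
    rw [← deconcatProd_emptyWordIndicator (fun w => iter w a), ← b.deconcatProd_rev_left]
    funext w
    rw [← deconcatProd_assoc, h, emptyWordIndicator_deconcatProd]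
  · intro h
    rw [h, deconcatProd_rev]

theorem equivalence_equivalent : Equivalence Equivalent where
  refl a := (equivalent_iff a a).2 fun _ => rfl
  symm h := (equivalent_iff _ _).2 fun w => ((equivalent_iff _ _).1 h w).symm
  trans h h' := (equivalent_iff _ _).2 fun w =>
    ((equivalent_iff _ _).1 h w).trans ((equivalent_iff _ _).1 h' w)

theorem iter_zero : (fun w => iter w zero) = emptyWordIndicator := by
  rw [← isUniversalCenter_iff]
  intro w hw
  cases w with
  | nil => exact absurd rfl hw
  | cons i w => simp [iter, iterFrom_cons, zero]

end CoeffSeq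

/-! ### Lipschitz primitives: compactness and continuity of iterated integrals -/

/-- Subtracting the primitive of the derivative leaves a Lipschitz, hence absolutely continuous,
function with derivative `0` almost everywhere; it is constant. -/
theorem LipschitzWith.intervalIntegral_deriv {E : Type*} [NormedAddCommGroup E] [NormedSpace ℝ E]
    [FiniteDimensional ℝ E] {C : ℝ≥0} {f : ℝ → E} (hf : LipschitzWith C f) (c d : ℝ) :
    ∫ x in c..d, deriv f x = f d - f c := by
  borelize E
  have := FiniteDimensional.complete ℝ E
  have hint : ∀ c d, IntervalIntegrable (deriv f) volume c d := fun c d =>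
    (intervalIntegrable_const (c := (C : ℝ))).mono_fun
      (stronglyMeasurable_deriv f).aestronglyMeasurable
      (.of_forall fun x => (norm_deriv_le_of_lipschitz hf).trans (le_abs_self _))
  let g (x : ℝ) := f x - ∫ t in c..x, deriv f t
  have hg : LipschitzWith (C + C) g := by
    refine hf.sub (LipschitzWith.of_dist_le_mul fun x y => ?_)
    rw [dist_eq_norm, intervalIntegral.integral_interval_sub_left (hint _ _) (hint _ _),
      dist_eq_norm, norm_eq_abs]
    exact intervalIntegral.norm_integral_le_of_norm_le_const
      fun x _ => norm_deriv_le_of_lipschitz hf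
  have hg0 : ∀ᵐ x, x ∈ Set.uIcc c d → HasDerivAt g 0 x := by
    filter_upwards [hf.ae_differentiableAt_real, (hint c d).ae_hasDerivAt_integral] with x h1 h2 hx
    have := h1.hasDerivAt.sub (h2 hx c Set.left_mem_uIcc)
    rwa [sub_self] at this
  obtain ⟨K, hK⟩ := (hg.lipschitzOnWith (s := Set.uIcc c d)).absolutelyContinuousOnInterval
    |>.const_of_ae_hasDerivAt_zero hg0
  have h1 := hK c Set.left_mem_uIcc
  have h2 := hK d Set.right_mem_uIcc
  simp only [g, intervalIntegral.integral_same, sub_zero] at h1 h2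
  rw [h1, ← h2]
  abel

namespace CoeffSeq

/-- The coefficients of `a` satisfy `sup |aᵢ| ≤ lⁱ`. -/
def BoundedBy (a : CoeffSeq) (l : ℝ≥0) : Prop :=
  ∀ (i : ℕ+) (x : ℝ), ‖a.coeff i x‖ ≤ (l : ℝ) ^ (i : ℕ)

theorem norm_integral_coeff_mul_le {a : CoeffSeq} {l : ℝ≥0} (ha : a.BoundedBy l) (i : ℕ+)
    {f : ℝ → ℂ} {C c d : ℝ} (hf : ∀ x ∈ Set.uIcc c d, ‖f x‖ ≤ C) :
    ‖∫ s in c..d, a.coeff i s * f s‖ ≤ (l : ℝ) ^ (i : ℕ) * C * |d - c| := by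
  refine intervalIntegral.norm_integral_le_of_norm_le_const fun x hx => ?_
  rw [norm_mul]
  exact mul_le_mul (ha i x) (hf x (Set.uIoc_subset_uIcc hx)) (norm_nonneg _) (by positivity)

/-- The constant depends only on `l` and `w`, which makes the later Riemann sums converge uniformly
in `a`. -/
theorem exists_forall_norm_iterFrom_le (l : ℝ≥0) (w : List ℕ+) :
    ∃ C : ℝ, 0 ≤ C ∧ ∀ a : CoeffSeq, a.BoundedBy l →
      ∀ c ∈ Set.Icc 0 (2 * π), ‖a.iterFrom w c‖ ≤ C := by
  induction w with
  | nil => exact ⟨1, zero_le_one, fun a _ c _ => by simp [iterFrom_nil]⟩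
  | cons i w ih =>
    obtain ⟨C, hC, h⟩ := ih
    refine ⟨(l : ℝ) ^ (i : ℕ) * C * (2 * π), by positivity, fun a ha c hc => ?_⟩
    refine (norm_integral_coeff_mul_le ha i fun x hx => h a ha x ?_).trans ?_
    · exact Set.uIcc_subset_Icc hc ⟨two_pi_pos.le, le_rfl⟩ hx
    · rw [abs_of_nonneg (by linarith [hc.2])]
      gcongr
      linarith [hc.1]

theorem exists_forall_norm_iterFrom_sub_le (l : ℝ≥0) (w : List ℕ+) :
    ∃ C : ℝ, 0 ≤ C ∧ ∀ a : CoeffSeq, a.BoundedBy l → ∀ c ∈ Set.Icc 0 (2 * π),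
      ∀ d ∈ Set.Icc 0 (2 * π), ‖a.iterFrom w c - a.iterFrom w d‖ ≤ C * |c - d| := by
  cases w with
  | nil => exact ⟨0, le_rfl, fun a _ c _ d _ => by simp [iterFrom_nil]⟩
  | cons i w =>
    obtain ⟨C, hC, h⟩ := exists_forall_norm_iterFrom_le l w
    refine ⟨(l : ℝ) ^ (i : ℕ) * C, by positivity, fun a ha c hc d hd => ?_⟩
    have hint := fun c d => a.intervalIntegrable_coeff_mul i (a.continuous_iterFrom w) c d
    rw [iterFrom_cons, iterFrom_cons, ← intervalIntegral.integral_add_adjacent_intervals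
      (hint c d) (hint d (2 * π)), add_sub_cancel_right, abs_sub_comm]
    exact norm_integral_coeff_mul_le ha i
      fun x hx => h a ha x (Set.uIcc_subset_Icc hc hd hx)

/-- Freezing `F` at the left end of each of `N` steps of length `h` costs at most `lⁱ K h²` per
step. The sum involves `aᵢ` only through increments of its primitive. -/
theorem norm_integral_sub_sum_le {a : CoeffSeq} {l : ℝ≥0} (ha : a.BoundedBy l) (i : ℕ+)
    {F : ℝ → ℂ} (hF : Continuous F) {K : ℝ} (hK : 0 ≤ K)
    (hFK : ∀ c ∈ Set.Icc 0 (2 * π), ∀ d ∈ Set.Icc 0 (2 * π), ‖F c - F d‖ ≤ K * |c - d|)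
    {c : ℝ} (hc : c ∈ Set.Icc 0 (2 * π)) {N : ℕ} (hN : N ≠ 0) :
    ‖(∫ s in c..(2 * π), a.coeff i s * F s) - ∑ j ∈ Finset.range N,
      (∫ s in (c + j * ((2 * π - c) / N))..(c + (j + 1 : ℕ) * ((2 * π - c) / N)), a.coeff i s) *
        F (c + j * ((2 * π - c) / N))‖ ≤ (l : ℝ) ^ (i : ℕ) * K * (2 * π) ^ 2 / N := by
  have hN' : (0 : ℝ) < N := by positivity
  set h := (2 * π - c) / N with hh
  have h0 : 0 ≤ h := div_nonneg (by linarith [hc.2]) hN'.le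
  have hNh : N * h = 2 * π - c := by rw [hh]; field_simp
  set t : ℕ → ℝ := fun j => c + j * h with ht
  have htmem : ∀ j ≤ N, t j ∈ Set.Icc 0 (2 * π) := fun j hj => by
    have : (j : ℝ) * h ≤ N * h := by gcongr
    have : 0 ≤ (j : ℝ) * h := by positivity
    exact ⟨by simp only [ht]; linarith [hc.1], by simp only [ht]; linarith⟩
  have htsub : ∀ j, t (j + 1) - t j = h := fun j => by simp only [ht]; push_cast; ring
  have hsum := intervalIntegral.sum_integral_adjacent_intervals (a := t) (n := N)
    (f := fun s => a.coeff i s * F s) fun k _ => a.intervalIntegrable_coeff_mul i hF _ _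
  rw [show t 0 = c by simp [ht], show t N = 2 * π by simp only [ht]; linarith] at hsum
  rw [← hsum, ← Finset.sum_sub_distrib]
  have hterm : ∀ j ∈ Finset.range N,
      ‖(∫ s in (t j)..(t (j + 1)), a.coeff i s * F s) -
        (∫ s in (t j)..(t (j + 1)), a.coeff i s) * F (t j)‖ ≤
      (l : ℝ) ^ (i : ℕ) * (K * h) * h := by
    intro j hj
    have hj := Finset.mem_range.1 hj
    rw [← intervalIntegral.integral_mul_const, ← intervalIntegral.integral_sub
      (a.intervalIntegrable_coeff_mul i hF _ _)
      (a.intervalIntegrable_coeff_mul i continuous_const _ _)]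
    simp only [← mul_sub]
    refine (norm_integral_coeff_mul_le ha i (C := K * h) fun x hx => ?_).trans ?_
    · have hx' := Set.uIcc_subset_Icc (htmem j hj.le) (htmem (j + 1) hj) hx
      refine (hFK x hx' _ (htmem j hj.le)).trans ?_
      have := htsub j
      rw [Set.uIcc_of_le (by linarith)] at hx
      rw [abs_of_nonneg (by linarith [hx.1])]
      gcongr
      linarith [hx.2]
    · rw [htsub, abs_of_nonneg h0]
  refine (norm_sum_le_of_le _ hterm).trans ?_
  rw [Finset.sum_const, Finset.card_range, nsmul_eq_mul]
  have h2 : N * ((l : ℝ) ^ (i : ℕ) * (K * h) * h) =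
      (l : ℝ) ^ (i : ℕ) * K * (2 * π - c) ^ 2 / N := by
    rw [hh]; field_simp
  rw [h2]
  have := hc.1
  have := hc.2
  gcongr
  linarith

/-- The sequences of Lipschitz functions that are primitives of coefficient sequences bounded
by `l`. -/
def primitives (l : ℝ≥0) : Set (ℕ+ → ℝ → ℂ) :=
  {A | ∀ i, A i 0 = 0 ∧ LipschitzWith (l ^ (i : ℕ)) (A i)}

/-- Tychonoff: the conditions are closed under pointwise convergence and confine each value to a
closed ball. -/
theorem isCompact_primitives (l : ℝ≥0) : IsCompact (primitives l) := by
  have hc : IsCompact (Set.univ.pi fun i : ℕ+ => Set.univ.pi fun t : ℝ =>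
      Metric.closedBall (0 : ℂ) ((l : ℝ) ^ (i : ℕ) * |t|)) :=
    isCompact_univ_pi fun i => isCompact_univ_pi fun t => isCompact_closedBall _ _
  refine hc.of_isClosed_subset ?_ fun A hA i _ t _ => ?_
  · simp only [primitives, lipschitzWith_iff_dist_le_mul, Set.ofPred_forall, Set.ofPred_and]
    refine isClosed_iInter fun i => IsClosed.inter ?_ ?_
    · exact isClosed_eq (by fun_prop) continuous_const
    · refine isClosed_iInter fun x => isClosed_iInter fun y => ?_
      exact isClosed_le (by fun_prop) continuous_const
  · have h := (hA i).2.dist_le_mul t 0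
    rw [(hA i).1] at h
    simpa using h

/-- The coefficient sequence of derivatives of a sequence of primitives. -/
noncomputable def ofPrimitives {l : ℝ≥0} (hl : 0 < l) (A : primitives l) : CoeffSeq where
  -- `deriv` is `0` where the primitive is not differentiable, so the bound holds everywhere, not
  -- just almost everywhere.
  coeff i t := deriv (A.1 i) (angleRep t)
  measurable_coeff i := (measurable_deriv _).comp measurable_angleRep
  periodic_coeff i t := by simp only [angleRep_periodic t]
  bound := ⟨l, hl, fun i x => by
    simpa using norm_deriv_le_of_lipschitz (x₀ := angleRep x) (A.2 i).2⟩

variable {l : ℝ≥0} (hl : 0 < l)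

theorem boundedBy_ofPrimitives (A : primitives l) : (ofPrimitives hl A).BoundedBy l :=
  fun i x => by
    simpa [ofPrimitives] using norm_deriv_le_of_lipschitz (x₀ := angleRep x) (A.2 i).2

theorem integral_ofPrimitives (A : primitives l) (i : ℕ+) {c d : ℝ} (hc : c ∈ Set.Icc 0 (2 * π))
    (hd : d ∈ Set.Icc 0 (2 * π)) :
    ∫ s in c..d, (ofPrimitives hl A).coeff i s = A.1 i d - A.1 i c := by
  rw [← (A.2 i).2.intervalIntegral_deriv]
  refine intervalIntegral.integral_congr_ae (.of_forall fun x hx => ?_)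
  have hx' : x ∈ Set.Ioc 0 (2 * π) :=
    ⟨(le_min hc.1 hd.1).trans_lt hx.1, hx.2.trans (max_le hc.2 hd.2)⟩
  simp only [ofPrimitives, angleRep_eq_self hx']

theorem continuous_iterFrom_ofPrimitives (w : List ℕ+) {c : ℝ} (hc : c ∈ Set.Icc 0 (2 * π)) :
    Continuous fun A : primitives l => (ofPrimitives hl A).iterFrom w c := by
  induction w generalizing c with
  | nil => exact continuous_const
  | cons i w ih =>
    obtain ⟨K, hK, hFK⟩ := exists_forall_norm_iterFrom_sub_le l w
    have hmem : ∀ N : ℕ, ∀ j ≤ N + 1,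
        c + j * ((2 * π - c) / (N + 1 : ℕ)) ∈ Set.Icc 0 (2 * π) := fun N j hj => by
      have h0 : 0 ≤ (2 * π - c) / (N + 1 : ℕ) := div_nonneg (by linarith [hc.2]) (by positivity)
      have h1 : ((N + 1 : ℕ) : ℝ) * ((2 * π - c) / (N + 1 : ℕ)) = 2 * π - c := by field_simp
      have h2 : (j : ℝ) * ((2 * π - c) / (N + 1 : ℕ)) ≤
        ((N + 1 : ℕ) : ℝ) * ((2 * π - c) / (N + 1 : ℕ)) := by gcongr
      have h3 : 0 ≤ (j : ℝ) * ((2 * π - c) / (N + 1 : ℕ)) := by positivity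
      exact ⟨by linarith [hc.1], by linarith⟩
    -- Riemann–Stieltjes sums with `N + 1` steps, which avoids division by zero; each is continuous
    -- by the induction hypothesis.
    let S : ℕ → primitives l → ℂ := fun N A => ∑ j ∈ Finset.range (N + 1),
      (∫ s in (c + j * ((2 * π - c) / (N + 1 : ℕ)))..
        (c + (j + 1 : ℕ) * ((2 * π - c) / (N + 1 : ℕ))), (ofPrimitives hl A).coeff i s) *
        (ofPrimitives hl A).iterFrom w (c + j * ((2 * π - c) / (N + 1 : ℕ)))
    have hS : ∀ N, Continuous (S N) := fun N => by
      refine continuous_finsetSum _ fun j hj => ?_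
      have hj := Finset.mem_range.1 hj
      refine Continuous.mul ?_ (ih (hmem N j hj.le))
      simp only [integral_ofPrimitives hl _ i (hmem N j hj.le) (hmem N (j + 1) hj)]
      have hcont : ∀ t : ℝ, Continuous fun A : primitives l => A.1 i t := fun t =>
        (continuous_apply t).comp ((continuous_apply i).comp continuous_subtype_val)
      exact (hcont _).sub (hcont _)
    have hlim : TendstoUniformly S
        (fun A : primitives l => (ofPrimitives hl A).iterFrom (i :: w) c) Filter.atTop := by
      rw [Metric.tendstoUniformly_iff]
      intro ε hε
      have h := (tendsto_const_div_atTop_nhds_zero_nat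
        ((l : ℝ) ^ (i : ℕ) * K * (2 * π) ^ 2)).comp (Filter.tendsto_add_atTop_nat 1)
      filter_upwards [h.eventually_lt_const hε] with N hN A
      have hA := boundedBy_ofPrimitives hl A
      rw [dist_eq_norm]
      exact (norm_integral_sub_sum_le hA i (continuous_iterFrom _ w) hK (hFK _ hA) hc
        N.succ_ne_zero).trans_lt hN
    exact hlim.continuous (Filter.Frequently.of_forall hS)

theorem iterFrom_congr_ae {a b : CoeffSeq}
    (h : ∀ i, ∀ᵐ x, x ∈ Set.Ioc 0 (2 * π) → a.coeff i x = b.coeff i x) (w : List ℕ+) {c : ℝ}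
    (hc : c ∈ Set.Icc 0 (2 * π)) : a.iterFrom w c = b.iterFrom w c := by
  induction w generalizing c with
  | nil => rfl
  | cons i w ih =>
    rw [iterFrom_cons, iterFrom_cons]
    refine intervalIntegral.integral_congr_ae ?_
    filter_upwards [h i] with x hx hxc
    rw [Set.uIoc_of_le hc.2] at hxc
    have hx0 : x ∈ Set.Ioc 0 (2 * π) := ⟨hc.1.trans_lt hxc.1, hxc.2⟩
    rw [hx hx0, ih ⟨hx0.1.le, hx0.2⟩]

/-- By Lebesgue differentiation, the derivative of the primitive of `aᵢ` is `aᵢ` almost everywhere.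
-/
theorem exists_ofPrimitives_iter_eq {a : CoeffSeq} (ha : a.BoundedBy l) :
    ∃ A : primitives l, ∀ w, iter w (ofPrimitives hl A) = iter w a := by
  have hint := fun i c d => a.intervalIntegrable_coeff i c d
  refine ⟨⟨fun i t => ∫ s in (0 : ℝ)..t, a.coeff i s, fun i => ⟨intervalIntegral.integral_same,
    LipschitzWith.of_dist_le_mul fun x y => ?_⟩⟩, fun w => iterFrom_congr_ae (fun i => ?_) w
      ⟨le_rfl, two_pi_pos.le⟩⟩
  · rw [dist_eq_norm, intervalIntegral.integral_interval_sub_left (hint _ _ _) (hint _ _ _),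
      dist_eq_norm, norm_eq_abs]
    exact intervalIntegral.norm_integral_le_of_norm_le_const fun s _ => by simpa using ha i s
  · filter_upwards [(hint i 0 (2 * π)).ae_hasDerivAt_integral] with x hx hx0
    simp only [ofPrimitives, angleRep_eq_self hx0]
    rw [Set.uIcc_of_le two_pi_pos.le] at hx
    exact (hx ⟨hx0.1.le, hx0.2⟩ 0 ⟨le_rfl, two_pi_pos.le⟩).deriv

/-! ### Dilations of coefficient sequences -/

/-- The grading of words in which the letter `i` has weight `i`. -/
def weight (w : List ℕ+) : ℕ := (w.map fun i : ℕ+ => (i : ℕ)).sum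

theorem weight_cons (i : ℕ+) (w : List ℕ+) : weight (i :: w) = i + weight w := by
  simp [weight]

theorem weight_ne_zero {w : List ℕ+} (hw : w ≠ []) : weight w ≠ 0 := by
  cases w with
  | nil => exact absurd rfl hw
  | cons i w => have := i.pos; rw [weight_cons]; omega

/-- The dilation `aᵢ ↦ sⁱ aᵢ`. -/
noncomputable def dilate (s : ℝ) (a : CoeffSeq) : CoeffSeq where
  coeff i t := (s : ℂ) ^ (i : ℕ) * a.coeff i t
  measurable_coeff i := (a.measurable_coeff i).const_mul _
  periodic_coeff i t := by simp only [a.periodic_coeff i t]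
  bound := by
    obtain ⟨l, hl, ha⟩ := a.bound
    refine ⟨(|s| + 1) * l, by positivity, fun i x => ?_⟩
    rw [norm_mul, norm_pow, Complex.norm_real, norm_eq_abs, mul_pow]
    gcongr
    · linarith
    · exact ha i x

theorem iter_dilate (s : ℝ) (a : CoeffSeq) (w : List ℕ+) :
    iter w (a.dilate s) = (s : ℂ) ^ weight w * iter w a := by
  have h : ∀ c, (a.dilate s).iterFrom w c = (s : ℂ) ^ weight w * a.iterFrom w c := by
    induction w with
    | nil => intro c; simp [iterFrom_nil, weight]
    | cons i w ih =>
      intro c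
      rw [iterFrom_cons, iterFrom_cons, ← intervalIntegral.integral_const_mul]
      congr 1
      funext t
      simp only [dilate] at ih ⊢
      rw [ih, weight_cons, pow_add]
      ring
  exact h 0

end CoeffSeq

/-! ### Group structure and topology of `G(X)` -/

namespace CenterGroup

theorem mk_eq_mk_iff {a b : CoeffSeq} :
    mk a = mk b ↔ ∀ w, CoeffSeq.iter w a = CoeffSeq.iter w b :=
  (CoeffSeq.equivalence_equivalent.quot_mk_eq_iff a b).trans (CoeffSeq.equivalent_iff a b)

theorem basicIntegral_mk (w : List ℕ+) (a : CoeffSeq) :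
    basicIntegral w (mk a) = CoeffSeq.iter w a :=
  mk_eq_mk_iff.1 (Quot.out_eq (mk a)) w

theorem mk_surjective : Function.Surjective mk := Quot.mk_surjective

theorem basicIntegral_ext {g h : CenterGroup} (H : ∀ w, basicIntegral w g = basicIntegral w h) :
    g = h := by
  obtain ⟨a, rfl⟩ := mk_surjective g
  obtain ⟨b, rfl⟩ := mk_surjective h
  simpa only [mk_eq_mk_iff, basicIntegral_mk] using H

theorem basicIntegral_nil (g : CenterGroup) : basicIntegral [] g = 1 := rfl

-- Choosing representatives is harmless: the integrals of a product depend only on those of its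
-- factors, and they determine the class.
noncomputable local instance : Mul CenterGroup := ⟨fun g h => mk (CoeffSeq.concat g.out h.out)⟩

noncomputable local instance : One CenterGroup := ⟨mk CoeffSeq.zero⟩

noncomputable local instance : Inv CenterGroup := ⟨fun g => mk (CoeffSeq.rev g.out)⟩

theorem basicIntegral_mul (w : List ℕ+) (g h : CenterGroup) : basicIntegral w (g * h) =
    deconcatProd (fun u => basicIntegral u g) (fun u => basicIntegral u h) w := by
  change basicIntegral w (mk _) = _
  rw [basicIntegral_mk, CoeffSeq.iter_concat]
  rfl

theorem basicIntegral_one (w : List ℕ+) : basicIntegral w 1 = emptyWordIndicator w := by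
  rw [← congrFun CoeffSeq.iter_zero w]
  exact basicIntegral_mk _ _

theorem deconcatProd_inv (g : CenterGroup) :
    deconcatProd (fun u => basicIntegral u g⁻¹) (fun u => basicIntegral u g) =
      emptyWordIndicator := by
  rw [← CoeffSeq.deconcatProd_rev_left g.out]
  congr 1
  funext u
  exact basicIntegral_mk _ _

/-- The group structure on `G(X)` induced by concatenation. -/
noncomputable local instance instGroup : Group CenterGroup :=
  Group.ofLeftAxioms
    (fun f g h => basicIntegral_ext fun w => by
      simp only [basicIntegral_mul]
      exact deconcatProd_assoc (fun u => basicIntegral u f) (fun u => basicIntegral u g)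
        (fun u => basicIntegral u h) w)
    (fun g => basicIntegral_ext fun w => by
      simp only [basicIntegral_mul, basicIntegral_one]
      exact congrFun (emptyWordIndicator_deconcatProd _) w)
    (fun g => basicIntegral_ext fun w => by
      rw [basicIntegral_mul, deconcatProd_inv, basicIntegral_one])

theorem mk_mul_mk (a b : CoeffSeq) : mk a * mk b = mk (a.concat b) :=
  basicIntegral_ext fun w => by
    simp only [basicIntegral_mul, basicIntegral_mk, CoeffSeq.iter_concat]

theorem mk_zero : mk CoeffSeq.zero = 1 := rfl

theorem inv_mk (a : CoeffSeq) : (mk a)⁻¹ = mk a.rev := by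
  rw [inv_eq_iff_mul_eq_one, mk_mul_mk]
  refine basicIntegral_ext fun w => ?_
  rw [basicIntegral_mk, CoeffSeq.iter_concat, CoeffSeq.deconcatProd_rev, basicIntegral_one]

theorem iteratedIntegrals_separatesPoints :
    (iteratedIntegrals : Set (CenterGroup → ℂ)).SeparatesPoints := by
  intro g h hgh
  by_contra! H
  exact hgh (basicIntegral_ext fun w => H _ (Submodule.subset_span ⟨w, rfl⟩))

theorem isInducing_basicIntegral :
    IsInducing fun (g : CenterGroup) (w : List ℕ+) => basicIntegral w g :=
  inducing_iInf_to_pi _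

theorem isEmbedding_basicIntegral :
    IsEmbedding fun (g : CenterGroup) (w : List ℕ+) => basicIntegral w g :=
  ⟨isInducing_basicIntegral, fun _ _ h => basicIntegral_ext (congrFun h)⟩

theorem continuous_basicIntegral (w : List ℕ+) : Continuous (basicIntegral w) :=
  (continuous_apply w).comp isInducing_basicIntegral.continuous

theorem continuous_iff {Y : Type*} [TopologicalSpace Y] {f : Y → CenterGroup} :
    Continuous f ↔ ∀ w, Continuous fun y => basicIntegral w (f y) := by
  rw [isInducing_basicIntegral.continuous_iff, continuous_pi_iff]
  rfl

/-- In Chen's identity for `g⁻¹ * g = 1` the full-prefix term is the integral of `w` at `g⁻¹` times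
`1`; it is solved for in terms of shorter prefixes. -/
theorem continuous_basicIntegral_inv (w : List ℕ+) :
    Continuous fun g : CenterGroup => basicIntegral w g⁻¹ := by
  induction h : w.length using Nat.strong_induction_on generalizing w with
  | _ n ih =>
    subst h
    have key : ∀ g : CenterGroup, basicIntegral w g⁻¹ = emptyWordIndicator w -
        ∑ k ∈ Finset.range w.length, basicIntegral (w.take k) g⁻¹ * basicIntegral (w.drop k) g := by
      intro g
      have h := congrFun (deconcatProd_inv g) w
      rw [deconcatProd_eq_sum, Finset.sum_range_succ] at h
      rw [← h]
      simp [basicIntegral_nil]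
    simp only [key]
    refine continuous_const.sub (continuous_finsetSum _ fun k hk => ?_)
    have hk := Finset.mem_range.1 hk
    exact (ih _ (by simpa using hk) _ rfl).mul (continuous_basicIntegral _)

theorem isTopologicalGroup : IsTopologicalGroup CenterGroup where
  continuous_mul := continuous_iff.2 fun w => by
    simp only [basicIntegral_mul]
    exact continuous_deconcatProd (fun u => (continuous_basicIntegral u).comp continuous_fst)
      (fun u => (continuous_basicIntegral u).comp continuous_snd) w
  continuous_inv := continuous_iff.2 continuous_basicIntegral_inv

instance : TopologicalSpace.MetrizableSpace CenterGroup :=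
  isEmbedding_basicIntegral.metrizableSpace

instance : SecondCountableTopology CenterGroup :=
  isInducing_basicIntegral.secondCountableTopology

/-! ### Contractibility, global and local -/

/-- The contraction of `G(X)` induced by dilations. -/
noncomputable def dilate (s : ℝ) (g : CenterGroup) : CenterGroup := mk (CoeffSeq.dilate s g.out)

theorem basicIntegral_dilate (s : ℝ) (g : CenterGroup) (w : List ℕ+) :
    basicIntegral w (dilate s g) = (s : ℂ) ^ CoeffSeq.weight w * basicIntegral w g := by
  rw [dilate, basicIntegral_mk, CoeffSeq.iter_dilate]
  rfl

theorem continuous_dilate : Continuous fun p : ℝ × CenterGroup => dilate p.1 p.2 := by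
  refine continuous_iff.2 fun w => ?_
  simp only [basicIntegral_dilate]
  have := (continuous_basicIntegral w).comp (continuous_snd (X := ℝ))
  exact ((Complex.continuous_ofReal.comp continuous_fst).pow _).mul this

theorem dilate_one (g : CenterGroup) : dilate 1 g = g :=
  basicIntegral_ext fun w => by simp [basicIntegral_dilate]

theorem dilate_zero (g : CenterGroup) : dilate 0 g = 1 :=
  basicIntegral_ext fun w => by
    rw [basicIntegral_dilate, basicIntegral_one]
    cases w with
    | nil => simp [CoeffSeq.weight, basicIntegral_nil, emptyWordIndicator]
    | cons i w => simp [CoeffSeq.weight_ne_zero, emptyWordIndicator]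

theorem contractibleSpace_of_dilate_mem {V : Set CenterGroup} (h1 : 1 ∈ V)
    (hV : ∀ s ∈ Set.Icc (0 : ℝ) 1, ∀ g ∈ V, dilate s g ∈ V) : ContractibleSpace V := by
  rw [contractible_iff_id_nullhomotopic]
  refine ⟨⟨1, h1⟩, ContinuousMap.Homotopic.symm ⟨⟨⟨fun p => ⟨dilate p.1 p.2,
    hV _ p.1.2 _ p.2.2⟩, ?_⟩, ?_, ?_⟩⟩⟩
  · refine Continuous.subtype_mk ?_ _
    exact continuous_dilate.comp ((continuous_subtype_val.comp continuous_fst).prodMk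
      (continuous_subtype_val.comp continuous_snd))
  · intro x
    exact Subtype.ext (dilate_zero _)
  · intro x
    exact Subtype.ext (dilate_one _)

instance : ContractibleSpace CenterGroup :=
  have := contractibleSpace_of_dilate_mem (Set.mem_univ 1) fun _ _ _ _ => Set.mem_univ _
  (Homeomorph.Set.univ CenterGroup).symm.contractibleSpace

/-- The basic neighbourhood of `1` cut out by finitely many iterated integrals. -/
def basicNhd (F : Finset (List ℕ+)) (ε : ℝ) : Set CenterGroup :=
  {g | ∀ w ∈ F, ‖basicIntegral w g - basicIntegral w 1‖ < ε}

theorem isOpen_basicNhd (F : Finset (List ℕ+)) (ε : ℝ) : IsOpen (basicNhd F ε) := by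
  have : basicNhd F ε = ⋂ w ∈ F, {g | ‖basicIntegral w g - basicIntegral w 1‖ < ε} := by
    ext; simp [basicNhd]
  rw [this]
  exact isOpen_biInter_finset fun w _ =>
    isOpen_lt ((continuous_basicIntegral w).sub continuous_const).norm continuous_const

theorem one_mem_basicNhd (F : Finset (List ℕ+)) {ε : ℝ} (hε : 0 < ε) : 1 ∈ basicNhd F ε := by
  intro w _
  simpa using hε

/-- Dilation fixes the integrals of `1`, so it multiplies each difference by a power of `s ≤ 1`. -/
theorem contractibleSpace_basicNhd (F : Finset (List ℕ+)) {ε : ℝ} (hε : 0 < ε) :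
    ContractibleSpace (basicNhd F ε) := by
  refine contractibleSpace_of_dilate_mem (one_mem_basicNhd F hε) fun s hs g hg w hw => ?_
  have h1 : basicIntegral w 1 = (s : ℂ) ^ CoeffSeq.weight w * basicIntegral w 1 := by
    rw [basicIntegral_one]
    cases w with
    | nil => simp [CoeffSeq.weight, emptyWordIndicator]
    | cons i w => simp [emptyWordIndicator]
  rw [basicIntegral_dilate, h1, ← mul_sub, norm_mul, norm_pow, Complex.norm_real, norm_eq_abs,
    abs_of_nonneg hs.1]
  exact (mul_le_of_le_one_left (norm_nonneg _) (pow_le_one₀ hs.1 hs.2)).trans_lt (hg w hw)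

theorem exists_basicNhd_subset {U : Set CenterGroup} (hU : U ∈ 𝓝 (1 : CenterGroup)) :
    ∃ (F : Finset (List ℕ+)) (ε : ℝ), 0 < ε ∧ basicNhd F ε ⊆ U := by
  rw [isInducing_basicIntegral.nhds_eq_comap, Filter.mem_comap] at hU
  obtain ⟨t, ht, htU⟩ := hU
  rw [nhds_pi, Filter.mem_pi] at ht
  obtain ⟨I, hI, u, hu, hut⟩ := ht
  choose r hr hru using fun w => Metric.mem_nhds_iff.1 (hu w)
  obtain ⟨ε, hε, hεr⟩ : ∃ ε : ℝ, 0 < ε ∧ ∀ w ∈ hI.toFinset, ε ≤ r w := by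
    have := (hI.toFinset.eventually_all (l := 𝓝[>] (0 : ℝ)) (p := fun w ε => ε ≤ r w)).2
      fun w _ => mem_nhdsWithin_of_mem_nhds (Iic_mem_nhds (hr w))
    obtain ⟨ε, h1, h2⟩ := (this.and self_mem_nhdsWithin).exists
    exact ⟨ε, h2, h1⟩
  refine ⟨hI.toFinset, ε, hε, fun g hg => htU (hut fun w hw => hru w ?_)⟩
  have hw' : w ∈ hI.toFinset := hI.mem_toFinset.2 hw
  rw [Metric.mem_ball, dist_eq_norm]
  exact (hg w hw').trans_le (hεr w hw')

theorem exists_contractible_nhd (y : CenterGroup) {U : Set CenterGroup} (hU : U ∈ 𝓝 y) :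
    ∃ V ⊆ U, IsOpen V ∧ y ∈ V ∧ ContractibleSpace V := by
  have := isTopologicalGroup
  have hU' : (fun x => y * x) ⁻¹' U ∈ 𝓝 (1 : CenterGroup) :=
    (continuous_const_mul y).continuousAt.preimage_mem_nhds (by simpa using hU)
  obtain ⟨F, ε, hε, hF⟩ := exists_basicNhd_subset hU'
  refine ⟨Homeomorph.mulLeft y '' basicNhd F ε, Set.image_subset_iff.2 hF,
    (Homeomorph.mulLeft y).isOpenMap _ (isOpen_basicNhd F ε),
    ⟨1, one_mem_basicNhd F hε, by simp⟩, ?_⟩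
  have := contractibleSpace_basicNhd F hε
  exact ((Homeomorph.mulLeft y).image (basicNhd F ε)).symm.contractibleSpace

theorem isLocallySimplyConnected : IsLocallySimplyConnected CenterGroup := by
  intro y U hU
  obtain ⟨V, hVU, hV, hy, _⟩ := exists_contractible_nhd y hU
  exact ⟨V, hVU, hV, hy, inferInstance⟩

instance : LocallyPathConnectedSpace CenterGroup where
  path_connected_basis y := by
    rw [Filter.hasBasis_self]
    intro U hU
    obtain ⟨V, hVU, hV, hy, _⟩ := exists_contractible_nhd y hU
    exact ⟨V, hV.mem_nhds hy, isPathConnected_iff_pathConnectedSpace.2 inferInstance, hVU⟩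

/-! ### Exhaustion by compact sets -/

/-- The classes of the coefficient sequences bounded by `l`. -/
def ballClasses (l : NNReal) : Set CenterGroup := {g | ∃ a : CoeffSeq, a.BoundedBy l ∧ mk a = g}

theorem isCompact_ballClasses {l : NNReal} (hl : 0 < l) : IsCompact (ballClasses l) := by
  have := isCompact_iff_compactSpace.1 (CoeffSeq.isCompact_primitives l)
  have hcont : Continuous fun A : CoeffSeq.primitives l => mk (CoeffSeq.ofPrimitives hl A) :=
    continuous_iff.2 fun w => by
      simp only [basicIntegral_mk]
      exact CoeffSeq.continuous_iterFrom_ofPrimitives hl w ⟨le_rfl, two_pi_pos.le⟩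
  convert isCompact_range hcont
  ext g
  constructor
  · rintro ⟨a, ha, rfl⟩
    obtain ⟨A, hA⟩ := CoeffSeq.exists_ofPrimitives_iter_eq hl ha
    exact ⟨A, mk_eq_mk_iff.2 hA⟩
  · rintro ⟨A, rfl⟩
    exact ⟨_, CoeffSeq.boundedBy_ofPrimitives hl A, rfl⟩

theorem ballClasses_mono : Monotone ballClasses := by
  rintro l m hlm g ⟨a, ha, rfl⟩
  exact ⟨a, fun i x => (ha i x).trans (pow_le_pow_left₀ l.2 hlm _), rfl⟩

theorem exists_monotone_isCompact_iUnion_eq_univ : ∃ K : ℕ → Set CenterGroup,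
    Monotone K ∧ (∀ n, IsCompact (K n)) ∧ ⋃ n, K n = Set.univ := by
  -- The shift by `1` keeps the radius positive, as `isCompact_ballClasses` requires.
  refine ⟨fun n => ballClasses (n + 1), fun m n h => ballClasses_mono (by gcongr),
    fun n => isCompact_ballClasses (by positivity), Set.eq_univ_of_forall fun g => ?_⟩
  obtain ⟨a, rfl⟩ := mk_surjective g
  obtain ⟨l, hl, ha⟩ := a.bound
  refine Set.mem_iUnion.2 ⟨⌈l⌉₊, a, fun i x => (ha i x).trans ?_, rfl⟩
  have := Nat.le_ceil l
  push_cast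
  gcongr
  linarith

/-! ### Unipotent representations -/

/-- The action of `g` on the suffixes of the word `w`: the entry at `(p, q)` is the iterated
integral of the factor of `w` between the positions `p` and `q`. -/
noncomputable def factorMatrix (w : List ℕ+) (g : CenterGroup) :
    Matrix (Fin (w.length + 1)) (Fin (w.length + 1)) ℂ :=
  Matrix.of fun p q => if p ≤ q then basicIntegral ((w.drop p).take (q - p)) g else 0

theorem factorMatrix_one (w : List ℕ+) : factorMatrix w 1 = 1 := by
  ext p q
  simp only [factorMatrix, Matrix.of_apply, Matrix.one_apply, basicIntegral_one]
  rcases lt_trichotomy p q with h | rfl | h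
  · rw [if_pos h.le, if_neg h.ne]
    have hne : (w.drop p).take (q - p) ≠ [] := by
      have := q.2
      have h' : (p : ℕ) < q := h
      rw [← List.length_pos_iff_ne_nil, List.length_take, List.length_drop]
      omega
    obtain ⟨i, v, hv⟩ := List.exists_cons_of_ne_nil hne
    rw [hv]
    rfl
  · simp [emptyWordIndicator]
  · rw [if_neg h.not_ge, if_neg h.ne']

theorem factorMatrix_mul (w : List ℕ+) (g h : CenterGroup) :
    factorMatrix w (g * h) = factorMatrix w g * factorMatrix w h := by
  ext p q
  simp only [factorMatrix, Matrix.mul_apply, Matrix.of_apply, basicIntegral_mul]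
  by_cases hpq : p ≤ q
  · have hpq' : (p : ℕ) ≤ q := hpq
    have hq := q.2
    have hlen : ((w.drop p).take (q - p)).length = q - p := by
      rw [List.length_take, List.length_drop]
      omega
    rw [if_pos hpq, deconcatProd_eq_sum, hlen]
    -- The cut after `k` letters of the factor corresponds to the intermediate index `r = p + k`;
    -- all other `r` contribute `0`.
    refine Finset.sum_bij_ne_zero (fun k hk _ => ⟨p + k, ?_⟩) ?_ ?_ ?_ ?_
    · have := Finset.mem_range.1 hk
      omega
    · intros
      exact Finset.mem_univ _
    · intro k _ _ k' _ _ hkk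
      simpa using hkk
    · intro r _ hr
      have h1 : (p : ℕ) ≤ r := by
        by_contra hn
        exact hr (by rw [if_neg (show ¬ p ≤ r from hn), zero_mul])
      have h2 : (r : ℕ) ≤ q := by
        by_contra hn
        exact hr (by rw [if_neg (show ¬ r ≤ q from hn), mul_zero])
      refine ⟨r - p, Finset.mem_range.2 (by omega), ?_, Fin.ext (by simp; omega)⟩
      rw [if_pos (show p ≤ r from h1), if_pos (show r ≤ q from h2)] at hr
      rw [List.take_take, List.drop_take, List.drop_drop, min_eq_left (by omega),
        show (q : ℕ) - p - (r - p) = q - r by omega, show (p : ℕ) + (r - p) = r by omega]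
      exact hr
    · intro k hk _
      have hk := Finset.mem_range.1 hk
      rw [if_pos (Fin.mk_le_mk.2 (by omega)), if_pos (Fin.mk_le_mk.2 (by omega)),
        List.take_take, List.drop_take, List.drop_drop, min_eq_left (by omega),
        show (p : ℕ) + k - p = k by omega, show (q : ℕ) - p - k = q - (p + k) by omega]
  · rw [if_neg hpq, Finset.sum_eq_zero]
    intro r _
    by_cases h1 : p ≤ r
    · rw [if_neg fun h2 : r ≤ q => hpq (h1.trans h2), mul_zero]
    · rw [if_neg h1, zero_mul]

/-- The matrix is strictly upper triangular, so its characteristic polynomial is a power of `X`;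
apply Cayley–Hamilton. -/
theorem isNilpotent_factorMatrix_sub_one (w : List ℕ+) (g : CenterGroup) :
    IsNilpotent (factorMatrix w g - 1) := by
  have htri : (factorMatrix w g - 1).IsUpperTriangular := fun p q hpq => by
    have hpq : q < p := hpq
    simp [factorMatrix, hpq.not_ge, hpq.ne']
  have hdiag : ∀ p, (factorMatrix w g - 1) p p = 0 := fun p => by
    simp [factorMatrix, basicIntegral_nil]
  refine ⟨w.length + 1, ?_⟩
  have h := Matrix.aeval_self_charpoly (factorMatrix w g - 1)
  rw [Matrix.charpoly_of_isUpperTriangular _ htri] at h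
  simpa [hdiag] using h

theorem isResiduallyTorsionFreeNilpotent : IsResiduallyTorsionFreeNilpotent CenterGroup := by
  intro g h hgh
  obtain ⟨w, hw⟩ : ∃ w, basicIntegral w g ≠ basicIntegral w h := by
    by_contra! H
    exact hgh (basicIntegral_ext H)
  let φ : CenterGroup →* Matrix (Fin (w.length + 1)) (Fin (w.length + 1)) ℂ :=
    { toFun := factorMatrix w
      map_one' := factorMatrix_one w
      map_mul' := factorMatrix_mul w }
  refine ⟨w.length + 1, φ.toHomUnits, fun x => isNilpotent_factorMatrix_sub_one w x, fun H => hw ?_⟩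
  have h1 : factorMatrix w g = factorMatrix w h := congrArg Units.val H
  -- The corner entry is the integral of the whole word `w`.
  simpa [factorMatrix] using congrFun (congrFun h1 0) (Fin.last _)

end CenterGroup

theorem theorem3p4 :
    Equivalence CoeffSeq.Equivalent ∧
    (∀ (w : List ℕ+) (a : CoeffSeq),
      CenterGroup.basicIntegral w (CenterGroup.mk a) = CoeffSeq.iter w a) ∧
    ∃ _ : Group CenterGroup,
      (∀ a b : CoeffSeq,
        CenterGroup.mk a * CenterGroup.mk b = CenterGroup.mk (a.concat b)) ∧
      CenterGroup.mk CoeffSeq.zero = 1 ∧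
      (∀ a : CoeffSeq, (CenterGroup.mk a)⁻¹ = CenterGroup.mk a.rev) ∧
      (CenterGroup.iteratedIntegrals : Set (CenterGroup → ℂ)).SeparatesPoints ∧
      IsTopologicalGroup CenterGroup ∧
      TopologicalSpace.SeparableSpace CenterGroup ∧
      TopologicalSpace.MetrizableSpace CenterGroup ∧
      (∃ K : ℕ → Set CenterGroup,
        Monotone K ∧ (∀ n, IsCompact (K n)) ∧ ⋃ n, K n = Set.univ) ∧
      ContractibleSpace CenterGroup ∧
      PathConnectedSpace CenterGroup ∧
      LocallyPathConnectedSpace CenterGroup ∧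
      IsLocallySimplyConnected CenterGroup ∧
      IsResiduallyTorsionFreeNilpotent CenterGroup := by
  refine ⟨CoeffSeq.equivalence_equivalent, CenterGroup.basicIntegral_mk, CenterGroup.instGroup,
    CenterGroup.mk_mul_mk, CenterGroup.mk_zero, CenterGroup.inv_mk,
    CenterGroup.iteratedIntegrals_separatesPoints, CenterGroup.isTopologicalGroup, inferInstance, inferInstance,
    CenterGroup.exists_monotone_isCompact_iUnion_eq_univ, inferInstance, inferInstance,
    inferInstance, CenterGroup.isLocallySimplyConnected,
    CenterGroup.isResiduallyTorsionFreeNilpotent⟩
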